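/- Let $(\mathfrak A_1,\theta_1)$ and $(\mathfrak A_2,\theta_2)$ be $\mathbb Z_2$-graded unital $C^*$-algebras, i.e. $\theta_i$ is a $*$-automorphism of $\mathfrak A_i$ with $\theta_i^2=\mathrm{id}$; an element $a\in\mathfrak A_i$ is homogeneous if it is even ($\theta_i(a)=a$) or odd ($\theta_i(a)=-a$). Their Fermi product $\mathfrak A_1\,\hat\otimes_F\,\mathfrak A_2$ is the algebraic tensor product $\mathfrak A_1\odot\mathfrak A_2$ over $\mathbb C$ with the product and involution determined, for homogeneous elements, by $$(a_1\otimes a_2)(a_1'\otimes a_2')=\varepsilon(a_2,a_1')\,a_1a_1'\otimes a_2a_2',\qquad (a_1\otimes a_2)^*=\varepsilon(a_1,a_2)\,a_1^*\otimes a_2^*,$$ where $\varepsilon(a,b)=-1$ if $a$ and $b$ are both odd, and $\varepsilon(a,b)=1$ otherwise. For $x\in\mathfrak A_1\,\hat\otimes_F\,\mathfrak A_2$ put $$\|x\|_{\max}=\sup\{\|\pi(x)\| : \pi \text{ a unital } *\text{-representation of } \mathfrak A_1\,\hat\otimes_F\,\mathfrak A_2 \text{ by bounded operators on a Hilbert space}\},$$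 $$\|x\|_{\min}=\sup\{\|\pi_{\omega_1\times\omega_2}(x)\| : \omega_i \text{ a state of } \mathfrak A_i \text{ with } \omega_i\circ\theta_i=\omega_i,\ i=1,2\},$$ where $\omega_1\times\omega_2$ is the linear functional with $(\omega_1\times\omega_2)(a_1\otimes a_2)=\omega_1(a_1)\omega_2(a_2)$ and $\pi_{\omega_1\times\omega_2}$ is its GNS representation, i.e. the $*$-representation by bounded operators on a Hilbert space, unique up to unitary equivalence, with a cyclic vector $\xi$ such that $\langle \xi,\pi_{\omega_1\times\omega_2}(x)\xi\rangle=(\omega_1\times\omega_2)(x)$ for all $x$ (inner product linear in the second variable). (The supremum over the empty set is $0$; it occurs only if one of the algebras is $\{0\}$.) Then both suprema are finite, and both the maximal norm $\|\cdot\|_{\max}$ and the spatial norm $\|\cdot\|_{\min}$ are $C^*$-cross norms on $\mathfrak A_1\,\hat\otimes_F\,\mathfrak A_2$: each is a norm on this complex vector space which satisfies $\|xy\|\le\|x\|\,\|y\|$ and $\|x^*x\|=\|x\|^2$ for all $x,y$, and $$\|a_1\otimes a_2\|=\|a_1\|\,\|a_2\|\qquad\text{for all homogeneous } a_1\in\mathfrak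 A_1,\ a_2\in\mathfrak A_2.$$ -/

import Mathlib

open scoped TensorProduct ComplexOrder

universe u v w

noncomputable section

/-- A `ℤ/2`-grading of a unital C⋆-algebra: an involutive ⋆-automorphism `θ`. -/
structure Z2Grading (A : Type u) [CStarAlgebra A] where
  /-- The grading automorphism. -/
  θ : A ≃⋆ₐ[ℂ] A
  involutive : ∀ a, θ (θ a) = a

/-- The nontrivial character of `ℤ/2`. Degrees are written additively: `0` is the even degree,
`1` the odd degree. -/
def gradeSign (i : ZMod 2) : ℂ := if i = 0 then 1 else -1

/-- The sign which is `-1` if both degrees are odd and `1` otherwise. -/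
def fermiSign (i j : ZMod 2) : ℂ := if i = 1 ∧ j = 1 then -1 else 1

namespace Z2Grading

variable {A : Type u} [CStarAlgebra A] (g : Z2Grading A)

/-- The homogeneous component of degree `i`: the even part `{a | θ a = a}` for `i = 0`, the odd
part `{a | θ a = -a}` for `i = 1`. -/
def part (i : ZMod 2) : Submodule ℂ A where
  carrier := {a | g.θ a = gradeSign i • a}
  add_mem' {a b} ha hb := by
    simp only [Set.mem_ofPred_eq] at *
    rw [map_add, ha, hb, smul_add]
  zero_mem' := by simp
  smul_mem' c a ha := by
    simp only [Set.mem_ofPred_eq] at *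
    rw [map_smul, ha, smul_comm]

/-- An element is homogeneous if it is even or odd. -/
def IsHomogeneous (a : A) : Prop := ∃ i, a ∈ g.part i

/-- The projection `a ↦ (a ± θ a) / 2` onto the homogeneous component of degree `i`. -/
def proj (i : ZMod 2) : A →ₗ[ℂ] A where
  toFun a := (2⁻¹ : ℂ) • (a + gradeSign i • g.θ a)
  map_add' a b := by
    simp only [map_add, smul_add]
    abel
  map_smul' c a := by
    simp only [map_smul, RingHom.id_apply, smul_add]
    rw [smul_comm (gradeSign i) c, smul_comm (2⁻¹ : ℂ) c, smul_comm (2⁻¹ : ℂ) c]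

lemma mem_part {i : ZMod 2} {a : A} : a ∈ g.part i ↔ g.θ a = gradeSign i • a := Iff.rfl

lemma proj_apply (i : ZMod 2) (a : A) :
    g.proj i a = (2⁻¹ : ℂ) • (a + gradeSign i • g.θ a) := rfl

lemma zmod_two_cases (i : ZMod 2) : i = 0 ∨ i = 1 := by
  revert i; decide

lemma gradeSign_add (i j : ZMod 2) : gradeSign (i + j) = gradeSign i * gradeSign j := by
  obtain rfl | rfl := zmod_two_cases i <;> obtain rfl | rfl := zmod_two_cases j <;>
    simp [gradeSign, show (1 + 1 : ZMod 2) = 0 from rfl]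

lemma gradeSign_mul_self (i : ZMod 2) : gradeSign i * gradeSign i = 1 := by
  unfold gradeSign; split_ifs <;> norm_num

lemma proj_mem (i : ZMod 2) (a : A) : g.proj i a ∈ g.part i := by
  rw [mem_part, proj_apply, map_smul, map_add, map_smul, g.involutive, smul_comm (gradeSign i),
    smul_add (gradeSign i), smul_smul (gradeSign i), gradeSign_mul_self, one_smul, add_comm]

lemma proj_of_mem {i : ZMod 2} (j : ZMod 2) {a : A} (ha : a ∈ g.part i) :
    g.proj j a = if i = j then a else 0 := by
  rw [mem_part] at ha
  have h2 : (2⁻¹ : ℂ) • (a + a) = a := by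
    rw [← two_smul ℂ a, smul_smul]; norm_num
  rw [proj_apply, ha]
  obtain rfl | rfl := zmod_two_cases i <;> obtain rfl | rfl := zmod_two_cases j <;>
    simp only [gradeSign, one_ne_zero, zero_ne_one, if_true, if_false, one_smul, neg_smul,
      neg_neg, add_neg_cancel, smul_zero, h2]

lemma proj_zero_add_proj_one (a : A) : g.proj 0 a + g.proj 1 a = a := by
  simp only [proj_apply, gradeSign, if_true, one_ne_zero, if_false, ← smul_add]
  rw [one_smul, neg_one_smul, show a + g.θ a + (a + -g.θ a) = (2 : ℂ) • a by
    rw [two_smul]; abel, smul_smul]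
  norm_num

lemma star_mem {i : ZMod 2} {a : A} (ha : a ∈ g.part i) : star a ∈ g.part i := by
  rw [mem_part] at *
  rw [map_star, ha, star_smul]
  congr 1
  unfold gradeSign; split_ifs <;> simp

instance : SetLike.GradedMonoid g.part where
  one_mem := by simp [mem_part, gradeSign]
  mul_mem {i j a b} ha hb := by
    rw [mem_part] at *
    rw [map_mul, ha, hb, gradeSign_add, smul_mul_smul_comm]

instance : DirectSum.Decomposition g.part :=
  DirectSum.Decomposition.ofLinearMap g.part
    (∑ i : ZMod 2, DirectSum.lof ℂ (ZMod 2) (fun i => g.part i) i ∘ₗ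
      (g.proj i).codRestrict (g.part i) (g.proj_mem i))
    (by
      ext a
      have : (Finset.univ : Finset (ZMod 2)) = {0, 1} := rfl
      simp [this, g.proj_zero_add_proj_one a])
    (by
      ext i a : 2
      simp only [LinearMap.comp_apply, LinearMap.sum_apply, DirectSum.coeLinearMap_lof,
        LinearMap.id_apply]
      rw [Finset.sum_eq_single i]
      · congr 1
        exact Subtype.ext (by simp [g.proj_of_mem i a.2])
      · intro j _ hj
        rw [show (g.proj j).codRestrict (g.part j) (g.proj_mem j) (a : A) = 0 from
          Subtype.ext (by simp [g.proj_of_mem j a.2, hj.symm]), map_zero]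
      · simp)

instance : GradedAlgebra g.part where

end Z2Grading

variable {A : Type u} [CStarAlgebra A] {B : Type v} [CStarAlgebra B]

/-- The Fermi product: the algebraic tensor product `A ⊗[ℂ] B` with the product
`(a ⊗ b) (a' ⊗ b') = ± aa' ⊗ bb'` for homogeneous `b`, `a'`, the sign being `-1` exactly if both
`b` and `a'` are odd. -/
abbrev FermiProduct (g₁ : Z2Grading A) (g₂ : Z2Grading B) : Type (max u v) :=
  GradedTensorProduct ℂ g₁.part g₂.part

namespace FermiProduct

variable (g₁ : Z2Grading A) (g₂ : Z2Grading B)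

/-- The elementary tensor `a ⊗ b` as an element of the Fermi product. -/
def tmul (a : A) (b : B) : FermiProduct g₁ g₂ := GradedTensorProduct.of ℂ g₁.part g₂.part (a ⊗ₜ b)

/-- The involution `x* = ∑ᵢⱼ ± xᵢⱼ*`, where `xᵢⱼ` is the component of `x` of bidegree `(i, j)`,
the star on the right is that of `A ⊗[ℂ] B`, `(a ⊗ b)* = a* ⊗ b*`, and the sign is `-1` exactly
if `i` and `j` are both odd. -/
instance : Star (FermiProduct g₁ g₂) where
  star x := GradedTensorProduct.of ℂ g₁.part g₂.part
    (∑ i : ZMod 2, ∑ j : ZMod 2, fermiSign i j •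
      star (TensorProduct.map (g₁.proj i) (g₂.proj j)
        ((GradedTensorProduct.of ℂ g₁.part g₂.part).symm x)))

variable {g₁ g₂}

lemma star_def (x : FermiProduct g₁ g₂) : star x = GradedTensorProduct.of ℂ g₁.part g₂.part
    (∑ i : ZMod 2, ∑ j : ZMod 2, fermiSign i j •
      star (TensorProduct.map (g₁.proj i) (g₂.proj j)
        ((GradedTensorProduct.of ℂ g₁.part g₂.part).symm x))) := rfl

lemma star_tmul {i j : ZMod 2} {a : A} {b : B} (ha : a ∈ g₁.part i) (hb : b ∈ g₂.part j) :
    star (tmul g₁ g₂ a b) = fermiSign i j • tmul g₁ g₂ (star a) (star b) := by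
  rw [star_def, tmul, GradedTensorProduct.of_symm_of, Finset.sum_eq_single i,
    Finset.sum_eq_single j]
  · simp [g₁.proj_of_mem i ha, g₂.proj_of_mem j hb, tmul]
  · intro k _ hk
    simp [g₂.proj_of_mem k hb, hk.symm]
  · simp
  · intro k _ hk
    simp [g₁.proj_of_mem k ha, hk.symm]
  · simp

lemma tmul_mul_tmul {j k : ZMod 2} (a : A) {b : B} {a' : A} (b' : B)
    (hb : b ∈ g₂.part j) (ha' : a' ∈ g₁.part k) :
    tmul g₁ g₂ a b * tmul g₁ g₂ a' b' = fermiSign j k • tmul g₁ g₂ (a * a') (b * b') := by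
  have h := GradedTensorProduct.tmul_coe_mul_coe_tmul (R := ℂ) g₁.part g₂.part a ⟨b, hb⟩ ⟨a', ha'⟩ b'
  refine h.trans ?_
  obtain rfl | rfl := Z2Grading.zmod_two_cases j <;>
    obtain rfl | rfl := Z2Grading.zmod_two_cases k <;> simp [fermiSign, tmul]

lemma induction_homogeneous {p : FermiProduct g₁ g₂ → Prop} (x : FermiProduct g₁ g₂)
    (h0 : p 0) (ht : ∀ i j a b, a ∈ g₁.part i → b ∈ g₂.part j → p (tmul g₁ g₂ a b))
    (ha : ∀ x y, p x → p y → p (x + y)) : p x := by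
  induction x using TensorProduct.induction_on with
  | zero => exact h0
  | add x y hx hy => exact ha x y hx hy
  | tmul a b =>
    have : tmul g₁ g₂ a b = tmul g₁ g₂ (g₁.proj 0 a) (g₂.proj 0 b) +
        tmul g₁ g₂ (g₁.proj 0 a) (g₂.proj 1 b) + (tmul g₁ g₂ (g₁.proj 1 a) (g₂.proj 0 b) +
        tmul g₁ g₂ (g₁.proj 1 a) (g₂.proj 1 b)) := by
      simp only [tmul, ← map_add, ← TensorProduct.tmul_add, ← TensorProduct.add_tmul,
        Z2Grading.proj_zero_add_proj_one]
    change p (tmul g₁ g₂ a b)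
    rw [this]
    have h := fun i j => ht i j _ _ (g₁.proj_mem i a) (g₂.proj_mem j b)
    exact ha _ _ (ha _ _ (h 0 0) (h 0 1)) (ha _ _ (h 1 0) (h 1 1))

lemma star_add' (x y : FermiProduct g₁ g₂) : star (x + y) = star x + star y := by
  simp only [star_def, map_add, star_add, smul_add, Finset.sum_add_distrib]

lemma star_smul' (c : ℂ) (x : FermiProduct g₁ g₂) : star (c • x) = star c • star x := by
  simp only [star_def, map_smul, star_smul, map_sum, Finset.smul_sum]
  exact Finset.sum_congr rfl fun i _ => Finset.sum_congr rfl fun j _ => smul_comm _ _ _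

lemma star_fermiSign (i j : ZMod 2) : star (fermiSign i j) = fermiSign i j := by
  unfold fermiSign; split_ifs <;> simp

instance : StarRing (FermiProduct g₁ g₂) where
  star_involutive x := by
    induction x using induction_homogeneous with
    | h0 => simp [star_def]
    | ht i j a b ha hb =>
      rw [star_tmul ha hb, star_smul', star_tmul (g₁.star_mem ha) (g₂.star_mem hb), smul_smul,
        star_fermiSign, star_star, star_star]
      unfold fermiSign; split_ifs <;> simp
    | ha x y hx hy => rw [star_add', star_add', hx, hy]
  star_add := star_add'
  star_mul x y := by
    induction x using induction_homogeneous with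
    | h0 => simp [star_def]
    | ha x x' hx hx' => rw [add_mul, star_add', hx, hx', star_add', mul_add]
    | ht i j a b ha hb =>
      induction y using induction_homogeneous with
      | h0 => simp [star_def]
      | ha y y' hy hy' => rw [mul_add, star_add', hy, hy', star_add', add_mul]
      | ht k l a' b' ha' hb' =>
        rw [tmul_mul_tmul a b' hb ha', star_smul',
          star_tmul (SetLike.mul_mem_graded ha ha') (SetLike.mul_mem_graded hb hb'),
          star_tmul ha hb, star_tmul ha' hb', smul_mul_smul_comm,
          tmul_mul_tmul _ _ (g₂.star_mem hb') (g₁.star_mem ha), smul_smul, smul_smul,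
          star_fermiSign, star_mul, star_mul]
        congr 1
        obtain rfl | rfl := Z2Grading.zmod_two_cases i <;>
          obtain rfl | rfl := Z2Grading.zmod_two_cases j <;>
          obtain rfl | rfl := Z2Grading.zmod_two_cases k <;>
          obtain rfl | rfl := Z2Grading.zmod_two_cases l <;>
          simp [fermiSign, show (1 + 1 : ZMod 2) = 0 from rfl]

instance : StarModule ℂ (FermiProduct g₁ g₂) where
  star_smul := star_smul'

end FermiProduct

/-- A state of a unital C⋆-algebra: a positive normalized linear functional. -/
structure IsState (φ : A →ₗ[ℂ] ℂ) : Prop where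
  nonneg : ∀ a, 0 ≤ φ (star a * a)
  map_one : φ 1 = 1

/-- An even state of a graded C⋆-algebra: a state invariant under the grading automorphism. -/
structure IsEvenState (g : Z2Grading A) (φ : A →ₗ[ℂ] ℂ) : Prop extends IsState φ where
  even : ∀ a, φ (g.θ a) = φ a

/-- The product functional `ω₁ × ω₂` on the Fermi product, `a ⊗ b ↦ ω₁ a * ω₂ b`. -/
def prodFunctional (g₁ : Z2Grading A) (g₂ : Z2Grading B) (ω₁ : A →ₗ[ℂ] ℂ) (ω₂ : B →ₗ[ℂ] ℂ) :
    FermiProduct g₁ g₂ →ₗ[ℂ] ℂ :=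
  LinearMap.mul' ℂ ℂ ∘ₗ TensorProduct.map ω₁ ω₂ ∘ₗ
    (GradedTensorProduct.of ℂ g₁.part g₂.part).symm.toLinearMap

/-- `(H, π, ξ)` is the GNS representation of the functional `φ` on a ⋆-algebra: `π` is a
⋆-representation on the Hilbert space `H` by bounded operators with cyclic vector `ξ`, and
`φ x = ⟨ξ, π x ξ⟩`. These properties determine `(H, π, ξ)` up to unitary equivalence. -/
structure IsGNS {R : Type w} [Ring R] [Algebra ℂ R] [StarRing R]
    {H : Type*} [NormedAddCommGroup H] [InnerProductSpace ℂ H] [CompleteSpace H]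
    (φ : R →ₗ[ℂ] ℂ) (π : R →⋆ₐ[ℂ] (H →L[ℂ] H)) (ξ : H) : Prop where
  cyclic : Dense (Set.range fun x => π x ξ)
  inner_eq : ∀ x, inner ℂ ξ (π x ξ) = φ x

/-- The values `‖π x‖`, where `π` runs over the ⋆-representations of the Fermi product on Hilbert
spaces. Hilbert spaces in the universe of the Fermi product suffice, since `‖π x‖` is the
supremum of the norms of the restrictions of `π x` to the cyclic subspaces of `π`. -/
def maxNormSet (g₁ : Z2Grading A) (g₂ : Z2Grading B) (x : FermiProduct g₁ g₂) : Set ℝ :=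
  {r | ∃ (H : Type (max u v)) (_ : NormedAddCommGroup H) (_ : InnerProductSpace ℂ H)
    (_ : CompleteSpace H) (π : FermiProduct g₁ g₂ →⋆ₐ[ℂ] (H →L[ℂ] H)), r = ‖π x‖}

/-- The maximal norm on the Fermi product. -/
def maxNorm (g₁ : Z2Grading A) (g₂ : Z2Grading B) (x : FermiProduct g₁ g₂) : ℝ :=
  sSup (maxNormSet g₁ g₂ x)

/-- The values `‖π x‖`, where `π` is the GNS representation of `ω₁ × ω₂` for even states
`ω₁`, `ω₂`. -/
def spatialNormSet (g₁ : Z2Grading A) (g₂ : Z2Grading B) (x : FermiProduct g₁ g₂) : Set ℝ :=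
  {r | ∃ (ω₁ : A →ₗ[ℂ] ℂ) (ω₂ : B →ₗ[ℂ] ℂ) (_ : IsEvenState g₁ ω₁) (_ : IsEvenState g₂ ω₂)
    (H : Type (max u v)) (_ : NormedAddCommGroup H) (_ : InnerProductSpace ℂ H)
    (_ : CompleteSpace H) (π : FermiProduct g₁ g₂ →⋆ₐ[ℂ] (H →L[ℂ] H)) (ξ : H),
    IsGNS (prodFunctional g₁ g₂ ω₁ ω₂) π ξ ∧ r = ‖π x‖}

/-- The spatial norm on the Fermi product. -/
def spatialNorm (g₁ : Z2Grading A) (g₂ : Z2Grading B) (x : FermiProduct g₁ g₂) : ℝ :=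
  sSup (spatialNormSet g₁ g₂ x)

/-- A C⋆-norm on a complex ⋆-algebra (not necessarily complete). -/
structure IsCStarNorm {R : Type w} [Ring R] [Algebra ℂ R] [StarRing R] (N : R → ℝ) : Prop where
  add_le : ∀ x y, N (x + y) ≤ N x + N y
  smul : ∀ (c : ℂ) (x : R), N (c • x) = ‖c‖ * N x
  eq_zero_iff : ∀ x, N x = 0 ↔ x = 0
  mul_le : ∀ x y, N (x * y) ≤ N x * N y
  star_mul_self : ∀ x, N (star x * x) = N x ^ 2

/-- A C⋆-norm on the Fermi product is cross if `‖a ⊗ b‖ = ‖a‖ ‖b‖` for homogeneous `a`, `b`. -/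
structure IsCrossNorm (g₁ : Z2Grading A) (g₂ : Z2Grading B) (N : FermiProduct g₁ g₂ → ℝ) : Prop
    extends IsCStarNorm N where
  cross : ∀ (a : A) (b : B), g₁.IsHomogeneous a → g₂.IsHomogeneous b →
    N (FermiProduct.tmul g₁ g₂ a b) = ‖a‖ * ‖b‖

end

/-!
Let `v₁`, `v₂` be the GNS maps of two states, `ω₁` being even. In
`⟨v₁ a ⊗ v₂ b, v₁ a' ⊗ v₂ b'⟩ = ω₁ (a* a') ω₂ (b* b')` the right-hand side is, for homogeneous
elements, `(ω₁ × ω₂) ((a ⊗ b)* (a' ⊗ b'))`: the two Fermi signs cancel unless `a* a'` is odd, and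
then `ω₁` vanishes on it. Hence `ω₁ × ω₂` is positive.

A ⋆-representation `π` of the Fermi product restricts to ⋆-representations of the two C⋆-algebras,
so it is contractive on each of them and `‖π (a ⊗ b)‖ ≤ ‖a‖ ‖b‖`. This bounds both suprema, and the
same bound for left multiplications yields the GNS representation of any positive functional.

In the other direction, the average of a state and its composition with the grading automorphism is
an even state, so there are enough of them to attain `‖a‖² = ω (a* a)` at a homogeneous `a`, which
gives the cross property, and for the functionals `ω (c* ·)` to separate the points of the algebra.
Their products then separate the points of the algebraic tensor product, so both seminorms are
norms.
-/

noncomputable section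

section PositiveFunctional

variable {R : Type w} [Ring R] [Algebra ℂ R] [StarRing R] {φ : R →ₗ[ℂ] ℂ}
  {H : Type*} [NormedAddCommGroup H] [InnerProductSpace ℂ H]

lemma inner_self_eq_ofReal_norm_sq (ξ : H) : inner ℂ ξ ξ = (‖ξ‖ ^ 2 : ℝ) := by
  rw [inner_self_eq_norm_sq_to_K, Complex.ofReal_pow, RCLike.ofReal_eq_complex_ofReal]

/-- Positivity of a linear functional on a ⋆-algebra. A ⋆-algebra carries no order, so positivity is
tested on the elements `x* x`. -/
def IsPositiveFunctional (φ : R →ₗ[ℂ] ℂ) : Prop := ∀ x, 0 ≤ φ (star x * x)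

lemma isPositiveFunctional_of_eq_inner {v : R → H}
    (h : ∀ x, φ (star x * x) = inner ℂ (v x) (v x)) : IsPositiveFunctional φ := by
  intro x
  rw [h, inner_self_eq_ofReal_norm_sq]
  exact Complex.zero_le_real.mpr (sq_nonneg _)

namespace IsPositiveFunctional

protected lemma map_star [StarModule ℂ R] (hφ : IsPositiveFunctional φ) (x : R) :
    φ (star x) = star (φ x) := by
  -- Polarization: `φ (y* y)` is real for `y = 1`, `1 + x` and `1 + i x`.
  have im_eq_zero (y : R) : (φ (star y * y)).im = 0 := (Complex.nonneg_iff.mp (hφ y)).2.symm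
  have im_one : (φ 1).im = 0 := by simpa using im_eq_zero 1
  have add_im : (φ x).im + (φ (star x)).im = 0 := by
    simpa [add_mul, mul_add, im_one, im_eq_zero, add_comm] using im_eq_zero (1 + x)
  have sub_re : -(φ (star x)).re + (φ x).re = 0 := by
    simpa [add_mul, mul_add, im_one, im_eq_zero] using im_eq_zero (1 + Complex.I • x)
  exact Complex.ext (neg_add_eq_zero.mp sub_re) (eq_neg_of_add_eq_zero_right add_im)

/-- The semi-inner product `⟨x, y⟩ = φ (x* y)` of a positive functional `φ`. -/
abbrev preInnerProductSpaceCore [StarModule ℂ R] (hφ : IsPositiveFunctional φ) :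
    PreInnerProductSpace.Core ℂ R where
  inner x y := φ (star x * y)
  conj_inner_symm x y := by rw [starRingEnd_apply, ← hφ.map_star, star_mul, star_star]
  re_inner_nonneg x := (Complex.nonneg_iff.mp (hφ x)).1
  add_left x y z := by rw [star_add, add_mul, map_add]
  smul_left x y c := by rw [star_smul, smul_mul_assoc, map_smul, smul_eq_mul, starRingEnd_apply]

end IsPositiveFunctional

/-- `v : R → H` exhibits the Hilbert space `H` as the separated completion of the ⋆-algebra `R` for
the semi-inner product `⟨x, y⟩ = φ (x* y)`. Unlike for `IsGNS`, left multiplication need not act by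
bounded operators on `H`. -/
structure IsGNSMap (φ : R →ₗ[ℂ] ℂ) (v : R →ₗ[ℂ] H) : Prop where
  denseRange : DenseRange v
  inner_eq : ∀ x y, inner ℂ (v x) (v y) = φ (star x * y)

lemma IsPositiveFunctional.exists_isGNSMap [StarModule ℂ R] (hφ : IsPositiveFunctional φ) :
    ∃ (H : Type w) (_ : NormedAddCommGroup H) (_ : InnerProductSpace ℂ H) (_ : CompleteSpace H)
      (v : R →ₗ[ℂ] H), IsGNSMap φ v := by
  let _ : SeminormedAddCommGroup R :=
    InnerProductSpace.Core.toSeminormedAddCommGroup (c := hφ.preInnerProductSpaceCore)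
  let _ : InnerProductSpace ℂ R := .ofCore hφ.preInnerProductSpaceCore
  let v : R →ₗ[ℂ] UniformSpace.Completion R :=
    { toFun := (↑)
      map_add' := UniformSpace.Completion.coe_add
      map_smul' := UniformSpace.Completion.coe_smul }
  exact ⟨UniformSpace.Completion R, inferInstance, inferInstance, inferInstance, v,
    UniformSpace.Completion.denseRange_coe, UniformSpace.Completion.inner_coe⟩

namespace IsGNSMap

variable {v : R →ₗ[ℂ] H}

lemma apply_star_mul_self (hv : IsGNSMap φ v) (x : R) :
    φ (star x * x) = (‖v x‖ ^ 2 : ℝ) := by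
  rw [← hv.inner_eq, inner_self_eq_ofReal_norm_sq]

lemma ext_of_apply_eq (hv : IsGNSMap φ v) {S T : H →L[ℂ] H} (h : ∀ x, S (v x) = T (v x)) : S = T :=
  DFunLike.coe_injective (hv.denseRange.equalizer S.continuous T.continuous (funext h))

variable [CompleteSpace H]

/-- The extension to `H` of the left multiplication by `x` on `R`, a junk value if the latter is not
bounded. -/
def leftMul (_ : IsGNSMap φ v) (x : R) : H →L[ℂ] H :=
  (v ∘ₗ LinearMap.mulLeft ℂ x).extendOfNorm v

variable (hv : IsGNSMap φ v) (hb : ∀ x, ∃ C : ℝ, ∀ y, ‖v (x * y)‖ ≤ C * ‖v y‖)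

include hb in
lemma leftMul_apply (x y : R) : hv.leftMul x (v y) = v (x * y) :=
  LinearMap.extendOfNorm_eq hv.denseRange (hb x) y

/-- The GNS representation of `φ` on `H`, for `φ` such that left multiplications are bounded. -/
def rep : R →⋆ₐ[ℂ] (H →L[ℂ] H) where
  toFun := hv.leftMul
  map_one' := hv.ext_of_apply_eq fun y => by
    rw [hv.leftMul_apply hb, one_mul, one_apply_eq_self]
  map_mul' a b := hv.ext_of_apply_eq fun y => by
    simp only [mul_apply_eq_comp, hv.leftMul_apply hb, mul_assoc]
  map_zero' := hv.ext_of_apply_eq fun y => by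
    rw [hv.leftMul_apply hb, zero_mul, map_zero, zero_apply]
  map_add' a b := hv.ext_of_apply_eq fun y => by
    simp only [add_apply, hv.leftMul_apply hb, add_mul, map_add]
  commutes' c := hv.ext_of_apply_eq fun y => by
    rw [hv.leftMul_apply hb, ← Algebra.smul_def, map_smul, Algebra.algebraMap_eq_smul_one,
      smul_apply, one_apply_eq_self]
  map_star' a := by
    rw [ContinuousLinearMap.star_eq_adjoint, ContinuousLinearMap.eq_adjoint_iff]
    refine fun ξ η => hv.denseRange.induction_on₂ (isClosed_eq (by fun_prop) (by fun_prop)) ?_ ξ η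
    intro x y
    simp only [hv.leftMul_apply hb, hv.inner_eq, star_mul, star_star, mul_assoc]

lemma isGNS_rep : IsGNS φ (hv.rep hb) (v 1) := by
  have rep_apply (x : R) : hv.rep hb x (v 1) = v x := by
    rw [← mul_one x, ← hv.leftMul_apply hb, mul_one]
    rfl
  refine ⟨by simpa only [rep_apply, DenseRange] using hv.denseRange, fun x => ?_⟩
  rw [rep_apply, hv.inner_eq, star_one, one_mul]

end IsGNSMap

namespace IsGNS

variable [CompleteSpace H] {π : R →⋆ₐ[ℂ] (H →L[ℂ] H)} {ξ : H}

lemma inner_apply_apply (h : IsGNS φ π ξ) (x y : R) :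
    inner ℂ (π x ξ) (π y ξ) = φ (star x * y) := by
  rw [← h.inner_eq, map_mul, map_star, ContinuousLinearMap.star_eq_adjoint, mul_apply_eq_comp,
    ContinuousLinearMap.adjoint_inner_right]

lemma apply_star_mul_self (h : IsGNS φ π ξ) (x : R) :
    φ (star x * x) = (‖π x ξ‖ ^ 2 : ℝ) := by
  rw [← h.inner_apply_apply, inner_self_eq_ofReal_norm_sq]

lemma apply_star_mul_self_le (h : IsGNS φ π ξ) (x : R) :
    φ (star x * x) ≤ (‖π x‖ ^ 2 : ℝ) * φ 1 := by
  have h_one : φ 1 = (‖ξ‖ ^ 2 : ℝ) := by simpa using h.apply_star_mul_self 1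
  rw [h.apply_star_mul_self, h_one, ← Complex.ofReal_mul, ← mul_pow, Complex.real_le_real]
  gcongr
  exact (π x).le_opNorm ξ

end IsGNS

/-- A representation of a ⋆-algebra by bounded operators on a Hilbert space, bundled so that one can
take suprema over families of representations. -/
structure HilbertRep (R : Type w) [Ring R] [Algebra ℂ R] [StarRing R] where
  H : Type w
  [normedAddCommGroup : NormedAddCommGroup H]
  [innerProductSpace : InnerProductSpace ℂ H]
  [completeSpace : CompleteSpace H]
  π : R →⋆ₐ[ℂ] (H →L[ℂ] H)

attribute [instance] HilbertRep.normedAddCommGroup HilbertRep.innerProductSpace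
  HilbertRep.completeSpace

end PositiveFunctional

section CStarAlgebra

variable {A : Type u} [CStarAlgebra A] {R : Type w} [Ring R] [Algebra ℂ R] [StarRing R]
  {φ : R →ₗ[ℂ] ℂ}

lemma IsPositiveFunctional.apply_star_mul_self_le {ψ : A →ₗ[ℂ] ℂ} (hψ : IsPositiveFunctional ψ)
    (a : A) : ψ (star a * a) ≤ (‖a‖ ^ 2 : ℝ) * ψ 1 := by
  let _ := CStarAlgebra.spectralOrder A
  let _ := CStarAlgebra.spectralOrderedRing A
  obtain ⟨c, hc⟩ := CStarAlgebra.nonneg_iff_eq_star_mul_self.mp <|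
    sub_nonneg.mpr (CStarAlgebra.star_mul_le_algebraMap_norm_sq (a := a))
  have h_nonneg := hψ c
  rwa [← hc, map_sub, IsScalarTower.algebraMap_apply ℝ ℂ A, Algebra.algebraMap_eq_smul_one,
    map_smul, smul_eq_mul, Complex.coe_algebraMap, sub_nonneg] at h_nonneg

lemma IsPositiveFunctional.comp_starAlgHom_conj (hφ : IsPositiveFunctional φ) (ι : A →⋆ₐ[ℂ] R)
    (y : R) : IsPositiveFunctional
      (φ ∘ₗ LinearMap.mulLeftRight ℂ (star y, y) ∘ₗ ι.toAlgHom.toLinearMap) := by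
  intro a
  have h : star (ι a * y) * (ι a * y) = star y * ι (star a * a) * y := by
    rw [star_mul, map_mul, map_star ι]
    simp only [mul_assoc]
  exact (hφ (ι a * y)).trans_eq (congrArg φ h)

lemma IsGNSMap.norm_map_mul_le {H : Type*} [NormedAddCommGroup H] [InnerProductSpace ℂ H]
    {v : R →ₗ[ℂ] H} (hv : IsGNSMap φ v) (ι : A →⋆ₐ[ℂ] R) (a : A) (y : R) :
    ‖v (ι a * y)‖ ≤ ‖a‖ * ‖v y‖ := by
  have hφ : IsPositiveFunctional φ :=
    isPositiveFunctional_of_eq_inner fun x => (hv.inner_eq x x).symm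
  have h := (hφ.comp_starAlgHom_conj ι y).apply_star_mul_self_le a
  have h_sq : (‖v (ι a * y)‖ ^ 2 : ℝ) ≤ ((‖a‖ ^ 2 : ℝ) * (‖v y‖ ^ 2 : ℝ) : ℂ) := by
    simpa [← hv.apply_star_mul_self, mul_assoc, map_star ι] using h
  rw [← Complex.ofReal_mul, ← mul_pow, Complex.real_le_real] at h_sq
  exact le_of_sq_le_sq h_sq (by positivity)

end CStarAlgebra

section State

variable {A : Type u} [CStarAlgebra A]

lemma IsState.isPositiveFunctional {φ : A →ₗ[ℂ] ℂ} (hφ : IsState φ) : IsPositiveFunctional φ :=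
  hφ.nonneg

lemma nonneg_of_forall_mem_closedBall {w : ℂ} {M : ℝ} (hM : 0 ≤ M)
    (hw : ∀ (z : ℂ) (r : ℝ), (∀ t ∈ Set.Icc 0 M, (t : ℂ) ∈ Metric.closedBall z r) →
      w ∈ Metric.closedBall z r) : 0 ≤ w := by
  have h_re : 0 ≤ w.re := by
    have h_dist : ‖w - M‖ ≤ M := by
      refine mem_closedBall_iff_norm.mp (hw M M fun t ht => ?_)
      rw [mem_closedBall_iff_norm, ← Complex.ofReal_sub, Complex.norm_real, Real.norm_eq_abs,
        abs_le]
      constructor <;> linarith [ht.1, ht.2]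
    have h_abs := abs_le.mp ((Complex.abs_re_le_norm _).trans h_dist)
    rw [Complex.sub_re, Complex.ofReal_re] at h_abs
    linarith
  -- The disc centred at `s i` through `M` approximates a half plane as `s → ±∞`.
  have h_im (s : ℝ) : (w.im - s) ^ 2 ≤ M ^ 2 + s ^ 2 := by
    have h_dist : ‖w - s * Complex.I‖ ≤ √(M ^ 2 + s ^ 2) := by
      refine mem_closedBall_iff_norm.mp (hw _ _ fun t ht => ?_)
      rw [mem_closedBall_iff_norm, Complex.norm_eq_sqrt_sq_add_sq]
      refine Real.sqrt_le_sqrt ?_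
      have := pow_le_pow_left₀ ht.1 ht.2 2
      simpa using this
    calc (w.im - s) ^ 2 = (w - s * Complex.I).im ^ 2 := by simp
      _ ≤ ‖w - s * Complex.I‖ ^ 2 := sq_le_sq.mpr (by
        rw [abs_norm]; exact Complex.abs_im_le_norm _)
      _ ≤ M ^ 2 + s ^ 2 := (Real.le_sqrt (norm_nonneg _) (by positivity)).mp h_dist
  refine Complex.nonneg_iff.mpr ⟨h_re, ?_⟩
  by_contra h_ne
  have h := h_im (-(M ^ 2 + 1) / (2 * w.im))
  have h_mul : w.im * (-(M ^ 2 + 1) / (2 * w.im)) = -(M ^ 2 + 1) / 2 := by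
    have : w.im ≠ 0 := Ne.symm h_ne
    field_simp
  nlinarith [sq_nonneg w.im]

lemma apply_mem_closedBall_of_spectrum_subset [Nontrivial A] {f : StrongDual ℂ A} (hf : ‖f‖ ≤ 1)
    (h_one : f 1 = 1) {a : A} [IsStarNormal a] {z : ℂ} {r : ℝ}
    (ha : spectrum ℂ a ⊆ Metric.closedBall z r) : f a ∈ Metric.closedBall z r := by
  have h_cfc : cfc (fun t : ℂ => t - z) a = a - algebraMap ℂ A z := by
    rw [cfc_sub _ _ a, cfc_id' ℂ a, cfc_const z a]
  have h_norm : ‖a - algebraMap ℂ A z‖ ≤ r := by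
    obtain ⟨t, ht⟩ := spectrum.nonempty a
    rw [← h_cfc]
    exact norm_cfc_le (Metric.nonempty_closedBall.mp ⟨t, ha ht⟩)
      fun t ht => mem_closedBall_iff_norm.mp (ha ht)
  have h_apply : f (a - algebraMap ℂ A z) = f a - z := by
    rw [map_sub, Algebra.algebraMap_eq_smul_one, map_smul, h_one, smul_eq_mul, mul_one]
  rw [mem_closedBall_iff_norm, ← h_apply]
  exact (f.le_of_opNorm_le hf _).trans (by rwa [one_mul])

lemma isState_of_norm_le_one {f : StrongDual ℂ A} (hf : ‖f‖ ≤ 1) (h_one : f 1 = 1) :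
    IsState (f : A →ₗ[ℂ] ℂ) := by
  have : Nontrivial A := ⟨1, 0, fun h => by simp [h] at h_one⟩
  let _ := CStarAlgebra.spectralOrder A
  let _ := CStarAlgebra.spectralOrderedRing A
  refine ⟨fun a => nonneg_of_forall_mem_closedBall (norm_nonneg (star a * a)) fun z r hz => ?_,
    h_one⟩
  have h_normal : IsStarNormal (star a * a) := (IsSelfAdjoint.star_mul_self a).isStarNormal
  refine apply_mem_closedBall_of_spectrum_subset hf h_one fun t ht => ?_
  have h_nonneg : 0 ≤ t := spectrum_nonneg_of_nonneg (star_mul_self_nonneg a) ht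
  have h_le : ‖t‖ ≤ ‖star a * a‖ := spectrum.norm_le_norm_of_mem ht
  rw [← Complex.norm_of_nonneg' h_nonneg]
  exact hz _ ⟨norm_nonneg t, h_le⟩

lemma exists_isState_apply_eq_of_mem_spectrum {a : A} [IsStarNormal a] {z : ℂ}
    (hz : z ∈ spectrum ℂ a) : ∃ φ : A →ₗ[ℂ] ℂ, IsState φ ∧ φ a = z := by
  let S := StarAlgebra.elemental ℂ a
  let a' : S := ⟨a, StarAlgebra.elemental.self_mem ℂ a⟩
  have h_closed : IsClosed (S : Set A) := StarAlgebra.elemental.isClosed ℂ a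
  have hz' : z ∈ spectrum ℂ a' := StarSubalgebra.spectrum_eq (hS := h_closed) (a := a') ▸ hz
  obtain ⟨χ, hχ⟩ := WeakDual.CharacterSpace.mem_spectrum_iff_exists.mp hz'
  have : Nontrivial S := ⟨1, 0, fun h => by simpa [h] using map_one χ⟩
  obtain ⟨f, hf, hf_norm⟩ := exists_extension_norm_eq S.toSubalgebra.toSubmodule
    (WeakDual.toStrongDual (χ : WeakDual ℂ S))
  refine ⟨f, isState_of_norm_le_one ?_ ((hf (1 : S)).trans (map_one χ)), (hf a').trans hχ⟩
  rw [hf_norm]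
  exact (WeakDual.CharacterSpace.norm_le_norm_one χ).trans CStarRing.norm_one.le

lemma exists_isState_apply_star_mul_self {a : A} (ha : a ≠ 0) :
    ∃ φ : A →ₗ[ℂ] ℂ, IsState φ ∧ φ (star a * a) = (‖a‖ ^ 2 : ℝ) := by
  let _ := CStarAlgebra.spectralOrder A
  let _ := CStarAlgebra.spectralOrderedRing A
  have : Nontrivial A := ⟨a, 0, ha⟩
  have h_normal : IsStarNormal (star a * a) := (IsSelfAdjoint.star_mul_self a).isStarNormal
  have h_mem : ((‖a‖ ^ 2 : ℝ) : ℂ) ∈ spectrum ℂ (star a * a) := by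
    rw [sq, ← CStarRing.norm_star_mul_self]
    exact spectrum.algebraMap_mem ℂ
      (CStarAlgebra.norm_mem_spectrum_of_nonneg (star_mul_self_nonneg a))
  exact exists_isState_apply_eq_of_mem_spectrum h_mem

end State

section EvenState

variable {A : Type u} [CStarAlgebra A] {g : Z2Grading A} {φ : A →ₗ[ℂ] ℂ}

lemma IsEvenState.apply_eq_zero (hφ : IsEvenState g φ) {a : A} (ha : a ∈ g.part 1) : φ a = 0 := by
  have h := hφ.even a
  rw [g.mem_part.mp ha, gradeSign, if_neg one_ne_zero, neg_one_smul, map_neg] at h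
  exact self_eq_neg.mp h.symm

lemma Z2Grading.proj_zero_apply (a : A) : g.proj 0 a = (2⁻¹ : ℂ) • (a + g.θ a) := by
  rw [g.proj_apply, gradeSign, if_pos rfl, one_smul]

lemma IsState.isEvenState_comp_proj_zero (hφ : IsState φ) (g : Z2Grading A) :
    IsEvenState g (φ ∘ₗ g.proj 0) where
  nonneg a := by
    have h_nonneg : 0 ≤ φ (star a * a) + φ (star (g.θ a) * g.θ a) :=
      add_nonneg (hφ.nonneg a) (hφ.nonneg (g.θ a))
    rw [LinearMap.comp_apply, Z2Grading.proj_zero_apply, map_smul, map_add, map_mul g.θ, map_star,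
      smul_eq_mul]
    exact mul_nonneg (by simp) h_nonneg
  map_one := by
    rw [LinearMap.comp_apply, g.proj_of_mem 0 SetLike.GradedOne.one_mem, if_pos rfl, hφ.map_one]
  even a := by
    simp only [LinearMap.comp_apply, Z2Grading.proj_zero_apply, g.involutive, add_comm]

lemma Z2Grading.IsHomogeneous.star_mul_self_mem_part_zero {a : A} (ha : g.IsHomogeneous a) :
    star a * a ∈ g.part 0 := by
  obtain ⟨i, hi⟩ := ha
  have h := SetLike.mul_mem_graded (g.star_mem hi) hi
  rwa [CharTwo.add_self_eq_zero] at h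

lemma Z2Grading.IsHomogeneous.exists_isEvenState_apply_star_mul_self {a : A}
    (ha : g.IsHomogeneous a) (ha_ne : a ≠ 0) :
    ∃ φ : A →ₗ[ℂ] ℂ, IsEvenState g φ ∧ φ (star a * a) = (‖a‖ ^ 2 : ℝ) := by
  obtain ⟨φ, hφ, h⟩ := exists_isState_apply_star_mul_self ha_ne
  refine ⟨φ ∘ₗ g.proj 0, hφ.isEvenState_comp_proj_zero g, ?_⟩
  rw [LinearMap.comp_apply, g.proj_of_mem 0 ha.star_mul_self_mem_part_zero, if_pos rfl, h]

lemma Z2Grading.eq_zero_of_forall_isEvenState (g : Z2Grading A) {a : A}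
    (ha : ∀ φ, IsEvenState g φ → φ (star a * a) = 0) : a = 0 := by
  by_contra h_ne
  obtain ⟨φ, hφ, h_eq⟩ := exists_isState_apply_star_mul_self h_ne
  have h_add : φ (star a * a) + φ (star (g.θ a) * g.θ a) = 0 := by
    simpa [Z2Grading.proj_zero_apply, map_star g.θ, ← mul_add] using
      ha _ (hφ.isEvenState_comp_proj_zero g)
  have h_zero : φ (star a * a) = 0 :=
    ((add_eq_zero_iff_of_nonneg (hφ.nonneg a) (hφ.nonneg (g.θ a))).mp h_add).1
  rw [h_eq, Complex.ofReal_eq_zero] at h_zero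
  exact h_ne (norm_eq_zero.mp (pow_eq_zero_iff two_ne_zero |>.mp h_zero))

end EvenState

section CStarSeminorm

variable {R : Type w} [Ring R] [Algebra ℂ R] [StarRing R]

/-- A C⋆-seminorm on a complex ⋆-algebra. -/
structure IsCStarSeminorm (p : R → ℝ) : Prop where
  add_le : ∀ x y, p (x + y) ≤ p x + p y
  smul : ∀ (c : ℂ) (x : R), p (c • x) = ‖c‖ * p x
  mul_le : ∀ x y, p (x * y) ≤ p x * p y
  star_mul_self : ∀ x, p (star x * x) = p x ^ 2

lemma isCStarSeminorm_norm_apply {B : Type*} [CStarAlgebra B] (π : R →⋆ₐ[ℂ] B) :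
    IsCStarSeminorm fun x => ‖π x‖ where
  add_le x y := map_add π x y ▸ norm_add_le _ _
  smul c x := by rw [map_smul, norm_smul]
  mul_le x y := map_mul π x y ▸ norm_mul_le _ _
  star_mul_self x := by rw [map_mul, map_star, CStarRing.norm_star_mul_self, sq]

namespace IsCStarSeminorm

variable {p : R → ℝ}

protected lemma map_zero (hp : IsCStarSeminorm p) : p 0 = 0 := by
  simpa using hp.smul 0 0

lemma nonneg (hp : IsCStarSeminorm p) (x : R) : 0 ≤ p x := by
  have h_neg : p (-x) = p x := by simpa using hp.smul (-1) x
  have h_add : p 0 ≤ p x + p (-x) := by simpa using hp.add_le x (-x)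
  rw [h_neg, hp.map_zero] at h_add
  linarith

lemma isCStarNorm (hp : IsCStarSeminorm p) (h : ∀ x, p x = 0 → x = 0) : IsCStarNorm p where
  add_le := hp.add_le
  smul := hp.smul
  eq_zero_iff x := ⟨h x, fun hx => hx ▸ hp.map_zero⟩
  mul_le := hp.mul_le
  star_mul_self := hp.star_mul_self

protected lemma iSup {ι : Type*} {p : ι → R → ℝ} (hp : ∀ i, IsCStarSeminorm (p i))
    (h_bdd : ∀ x, BddAbove (Set.range fun i => p i x)) : IsCStarSeminorm fun x => ⨆ i, p i x where
  add_le x y := by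
    refine Real.iSup_le (fun i => ((hp i).add_le x y).trans ?_) (add_nonneg ?_ ?_)
    · exact add_le_add (le_ciSup (h_bdd x) i) (le_ciSup (h_bdd y) i)
    all_goals exact Real.iSup_nonneg fun i => (hp i).nonneg _
  smul c x := by
    rw [Real.mul_iSup_of_nonneg (norm_nonneg c)]
    exact iSup_congr fun i => (hp i).smul c x
  mul_le x y := by
    have h_nonneg (z : R) : 0 ≤ ⨆ i, p i z := Real.iSup_nonneg fun i => (hp i).nonneg z
    refine Real.iSup_le (fun i => ((hp i).mul_le x y).trans ?_) (mul_nonneg ?_ ?_)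
    · exact mul_le_mul (le_ciSup (h_bdd x) i) (le_ciSup (h_bdd y) i) ((hp i).nonneg y) (h_nonneg x)
    all_goals exact h_nonneg _
  star_mul_self x := by
    rw [Real.iSup_pow_of_ne_zero (fun i => (hp i).nonneg x) two_ne_zero]
    exact iSup_congr fun i => (hp i).star_mul_self x

end IsCStarSeminorm

end CStarSeminorm

section TensorSlices

variable {R V W ι κ : Type*} [CommSemiring R] [AddCommMonoid V] [Module R V] [AddCommMonoid W]
  [Module R W] [Module.Free R W] {f : ι → V →ₗ[R] R} {t : V ⊗[R] W}

lemma tensor_eq_zero_of_forall_rTensor_eq_zero (hf : ∀ a, (∀ i, f i a = 0) → a = 0)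
    (ht : ∀ i, (f i).rTensor W t = 0) : t = 0 := by
  classical
  let 𝒞 := Module.Free.chooseBasis R W
  have slice_comm (i : ι) (k : Module.Free.ChooseBasisIndex R W) :
      f i ∘ₗ TensorProduct.rid R V ∘ₗ (𝒞.coord k).lTensor V =
        𝒞.coord k ∘ₗ TensorProduct.lid R W ∘ₗ (f i).rTensor W :=
    TensorProduct.ext' fun a b => by simp [mul_comm]
  refine (TensorProduct.equivFinsuppOfBasisRight 𝒞).injective (Finsupp.ext fun k => ?_)
  rw [TensorProduct.equivFinsuppOfBasisRight_apply, map_zero]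
  refine hf _ fun i => ?_
  simpa [ht i] using LinearMap.congr_fun (slice_comm i k) t

lemma tensor_eq_zero_of_forall_map_eq_zero {g : κ → W →ₗ[R] R}
    (hf : ∀ a, (∀ i, f i a = 0) → a = 0) (hg : ∀ b, (∀ j, g j b = 0) → b = 0)
    (ht : ∀ i j, LinearMap.mul' R R (TensorProduct.map (f i) (g j) t) = 0) : t = 0 := by
  refine tensor_eq_zero_of_forall_rTensor_eq_zero hf fun i => ?_
  refine (TensorProduct.lid R W).map_eq_zero_iff.mp (hg _ fun j => ?_)
  have slice_apply : g j ∘ₗ TensorProduct.lid R W ∘ₗ (f i).rTensor W =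
      LinearMap.mul' R R ∘ₗ TensorProduct.map (f i) (g j) :=
    TensorProduct.ext' fun a b => by simp
  exact (LinearMap.congr_fun slice_apply t).trans (ht i j)

end TensorSlices

variable {A : Type u} [CStarAlgebra A] {B : Type v} [CStarAlgebra B]

namespace FermiProduct

variable (g₁ : Z2Grading A) (g₂ : Z2Grading B)

lemma add_tmul (a a' : A) (b : B) :
    tmul g₁ g₂ (a + a') b = tmul g₁ g₂ a b + tmul g₁ g₂ a' b := by
  simp only [tmul, TensorProduct.add_tmul, map_add]

lemma tmul_add (a : A) (b b' : B) :
    tmul g₁ g₂ a (b + b') = tmul g₁ g₂ a b + tmul g₁ g₂ a b' := by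
  simp only [tmul, TensorProduct.tmul_add, map_add]

lemma star_tmul_one (a : A) : star (tmul g₁ g₂ a 1) = tmul g₁ g₂ (star a) 1 := by
  have h (i : ZMod 2) :
      star (tmul g₁ g₂ (g₁.proj i a) 1) = tmul g₁ g₂ (star (g₁.proj i a)) 1 := by
    rw [star_tmul (g₁.proj_mem i a) SetLike.GradedOne.one_mem, star_one, fermiSign,
      if_neg fun h => zero_ne_one h.2, one_smul]
  rw [← g₁.proj_zero_add_proj_one a, add_tmul, star_add, h, h, ← add_tmul, ← star_add]

lemma star_one_tmul (b : B) : star (tmul g₁ g₂ 1 b) = tmul g₁ g₂ 1 (star b) := by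
  have h (i : ZMod 2) :
      star (tmul g₁ g₂ 1 (g₂.proj i b)) = tmul g₁ g₂ 1 (star (g₂.proj i b)) := by
    rw [star_tmul SetLike.GradedOne.one_mem (g₂.proj_mem i b), star_one, fermiSign,
      if_neg fun h => zero_ne_one h.1, one_smul]
  rw [← g₂.proj_zero_add_proj_one b, tmul_add, star_add, h, h, ← tmul_add, ← star_add]

/-- The embedding `a ↦ a ⊗ 1` of the first factor as a ⋆-homomorphism. -/
def inl : A →⋆ₐ[ℂ] FermiProduct g₁ g₂ where
  __ := GradedTensorProduct.includeLeft g₁.part g₂.part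
  map_star' a := (star_tmul_one g₁ g₂ a).symm

/-- The embedding `b ↦ 1 ⊗ b` of the second factor as a ⋆-homomorphism. -/
def inr : B →⋆ₐ[ℂ] FermiProduct g₁ g₂ where
  __ := GradedTensorProduct.includeRight g₁.part g₂.part
  map_star' b := (star_one_tmul g₁ g₂ b).symm

lemma inl_mul_inr (a : A) (b : B) : inl g₁ g₂ a * inr g₁ g₂ b = tmul g₁ g₂ a b := by
  refine (tmul_mul_tmul a b SetLike.GradedOne.one_mem SetLike.GradedOne.one_mem).trans ?_
  rw [fermiSign, if_neg fun h => zero_ne_one h.1, one_smul, mul_one, one_mul]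

variable {g₁ g₂}

lemma norm_apply_tmul_le {C : Type*} [CStarAlgebra C] (π : FermiProduct g₁ g₂ →⋆ₐ[ℂ] C)
    (a : A) (b : B) : ‖π (tmul g₁ g₂ a b)‖ ≤ ‖a‖ * ‖b‖ := by
  rw [← inl_mul_inr, map_mul]
  refine norm_mul_le_of_le ?_ ?_
  · exact NonUnitalStarAlgHom.norm_apply_le (π.comp (inl g₁ g₂)) a
  · exact NonUnitalStarAlgHom.norm_apply_le (π.comp (inr g₁ g₂)) b

lemma bddAbove_range_norm_apply (x : FermiProduct g₁ g₂) :
    BddAbove (Set.range fun ρ : HilbertRep (FermiProduct g₁ g₂) => ‖ρ.π x‖) := by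
  suffices ∃ C, ∀ ρ : HilbertRep (FermiProduct g₁ g₂), ‖ρ.π x‖ ≤ C from
    this.imp fun C hC => Set.forall_mem_range.mpr hC
  induction x using induction_homogeneous with
  | h0 => exact ⟨0, fun ρ => by rw [map_zero, norm_zero]⟩
  | ht _ _ a b _ _ => exact ⟨‖a‖ * ‖b‖, fun ρ => norm_apply_tmul_le ρ.π a b⟩
  | ha x y hx hy =>
    obtain ⟨C, hC⟩ := hx
    obtain ⟨D, hD⟩ := hy
    exact ⟨C + D, fun ρ => map_add ρ.π x y ▸ norm_add_le_of_le (hC ρ) (hD ρ)⟩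

lemma exists_norm_map_mul_le {φ : FermiProduct g₁ g₂ →ₗ[ℂ] ℂ} {H : Type*} [NormedAddCommGroup H]
    [InnerProductSpace ℂ H] {v : FermiProduct g₁ g₂ →ₗ[ℂ] H} (hv : IsGNSMap φ v)
    (x : FermiProduct g₁ g₂) : ∃ C, ∀ y, ‖v (x * y)‖ ≤ C * ‖v y‖ := by
  induction x using induction_homogeneous with
  | h0 => exact ⟨0, fun y => by simp⟩
  | ht _ _ a b _ _ =>
    refine ⟨‖a‖ * ‖b‖, fun y => ?_⟩
    rw [← inl_mul_inr, mul_assoc, mul_assoc]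
    refine (hv.norm_map_mul_le (inl g₁ g₂) a _).trans ?_
    gcongr
    exact hv.norm_map_mul_le (inr g₁ g₂) b y
  | ha x x' hx hx' =>
    obtain ⟨C, hC⟩ := hx
    obtain ⟨D, hD⟩ := hx'
    refine ⟨C + D, fun y => ?_⟩
    rw [add_mul, add_mul, map_add]
    exact norm_add_le_of_le (hC y) (hD y)

theorem exists_isGNS {φ : FermiProduct g₁ g₂ →ₗ[ℂ] ℂ} (hφ : IsPositiveFunctional φ) :
    ∃ (ρ : HilbertRep (FermiProduct g₁ g₂)) (ξ : ρ.H), IsGNS φ ρ.π ξ := by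
  obtain ⟨H, _, _, _, v, hv⟩ := hφ.exists_isGNSMap
  have hb := exists_norm_map_mul_le hv
  exact ⟨⟨H, hv.rep hb⟩, v 1, hv.isGNS_rep hb⟩

end FermiProduct

section ProductFunctional

open FermiProduct

variable {g₁ : Z2Grading A} {g₂ : Z2Grading B} {ω₁ : A →ₗ[ℂ] ℂ} {ω₂ : B →ₗ[ℂ] ℂ}

lemma prodFunctional_tmul (a : A) (b : B) :
    prodFunctional g₁ g₂ ω₁ ω₂ (tmul g₁ g₂ a b) = ω₁ a * ω₂ b := rfl

lemma fermiSign_mul_fermiSign_of_add_ne_one {i k : ZMod 2} (h : i + k ≠ 1) (j : ZMod 2) :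
    fermiSign i j * fermiSign j k = 1 := by
  obtain rfl | rfl := Z2Grading.zmod_two_cases i <;>
    obtain rfl | rfl := Z2Grading.zmod_two_cases j <;>
    obtain rfl | rfl := Z2Grading.zmod_two_cases k <;> simp [fermiSign] at h ⊢

lemma prodFunctional_star_tmul_mul_tmul_of_mem (h₁ : IsEvenState g₁ ω₁) {i j k : ZMod 2}
    {a a' : A} {b : B} (b' : B) (ha : a ∈ g₁.part i) (hb : b ∈ g₂.part j) (ha' : a' ∈ g₁.part k) :
    prodFunctional g₁ g₂ ω₁ ω₂ (star (tmul g₁ g₂ a b) * tmul g₁ g₂ a' b') =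
      ω₁ (star a * a') * ω₂ (star b * b') := by
  rw [star_tmul ha hb, smul_mul_assoc, tmul_mul_tmul _ _ (g₂.star_mem hb) ha', smul_smul, map_smul,
    prodFunctional_tmul, smul_eq_mul]
  -- The two signs cancel unless `a* a'` is odd, and then `ω₁ (a* a') = 0`.
  by_cases hik : i + k = 1
  · have h_odd : star a * a' ∈ g₁.part 1 := hik ▸ SetLike.mul_mem_graded (g₁.star_mem ha) ha'
    rw [h₁.apply_eq_zero h_odd, zero_mul, mul_zero]
  · rw [fermiSign_mul_fermiSign_of_add_ne_one hik, one_mul]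

lemma prodFunctional_star_tmul_mul_tmul (h₁ : IsEvenState g₁ ω₁) (a a' : A) (b b' : B) :
    prodFunctional g₁ g₂ ω₁ ω₂ (star (tmul g₁ g₂ a b) * tmul g₁ g₂ a' b') =
      ω₁ (star a * a') * ω₂ (star b * b') := by
  have h (i j k : ZMod 2) := prodFunctional_star_tmul_mul_tmul_of_mem (ω₂ := ω₂) h₁ b'
    (g₁.proj_mem i a) (g₂.proj_mem j b) (g₁.proj_mem k a')
  rw [← g₁.proj_zero_add_proj_one a, ← g₁.proj_zero_add_proj_one a',
    ← g₂.proj_zero_add_proj_one b]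
  simp only [add_tmul, tmul_add, star_add, add_mul, mul_add, map_add, h]
  ring

lemma prodFunctional_star_tmul_mul (h₁ : IsEvenState g₁ ω₁) (a : A) (b : B)
    (x : FermiProduct g₁ g₂) :
    prodFunctional g₁ g₂ ω₁ ω₂ (star (tmul g₁ g₂ a b) * x) =
      prodFunctional g₁ g₂ (ω₁ ∘ₗ LinearMap.mulLeft ℂ (star a))
        (ω₂ ∘ₗ LinearMap.mulLeft ℂ (star b)) x := by
  induction x using induction_homogeneous with
  | h0 => simp only [mul_zero, map_zero]
  | ha x y hx hy => rw [mul_add, map_add, map_add, hx, hy]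
  | ht _ _ a' b' _ _ => exact prodFunctional_star_tmul_mul_tmul h₁ a a' b b'

/-- The linear map `a ⊗ b ↦ v₁ a ⊗ v₂ b`. For the GNS maps `vᵢ` of `ωᵢ`, it realizes the product
functional `ω₁ × ω₂` on the tensor product of the GNS spaces. -/
def prodMap {H₁ H₂ : Type*} [AddCommGroup H₁] [Module ℂ H₁] [AddCommGroup H₂] [Module ℂ H₂]
    (g₁ : Z2Grading A) (g₂ : Z2Grading B) (v₁ : A →ₗ[ℂ] H₁) (v₂ : B →ₗ[ℂ] H₂) :
    FermiProduct g₁ g₂ →ₗ[ℂ] H₁ ⊗[ℂ] H₂ :=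
  TensorProduct.map v₁ v₂ ∘ₗ (GradedTensorProduct.of ℂ g₁.part g₂.part).symm.toLinearMap

variable {H₁ : Type*} [NormedAddCommGroup H₁] [InnerProductSpace ℂ H₁]
  {H₂ : Type*} [NormedAddCommGroup H₂] [InnerProductSpace ℂ H₂]
  {v₁ : A →ₗ[ℂ] H₁} {v₂ : B →ₗ[ℂ] H₂}

lemma inner_prodMap_tmul (hv₁ : IsGNSMap ω₁ v₁) (hv₂ : IsGNSMap ω₂ v₂) (a a' : A) (b b' : B) :
    inner ℂ (prodMap g₁ g₂ v₁ v₂ (tmul g₁ g₂ a b)) (prodMap g₁ g₂ v₁ v₂ (tmul g₁ g₂ a' b')) =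
      ω₁ (star a * a') * ω₂ (star b * b') := by
  rw [← hv₁.inner_eq, ← hv₂.inner_eq, ← TensorProduct.inner_tmul]
  rfl

lemma inner_prodMap (h₁ : IsEvenState g₁ ω₁) (hv₁ : IsGNSMap ω₁ v₁) (hv₂ : IsGNSMap ω₂ v₂)
    (x y : FermiProduct g₁ g₂) :
    inner ℂ (prodMap g₁ g₂ v₁ v₂ x) (prodMap g₁ g₂ v₁ v₂ y) =
      prodFunctional g₁ g₂ ω₁ ω₂ (star x * y) := by
  induction x using induction_homogeneous with
  | h0 => simp
  | ha x x' hx hx' => rw [map_add, inner_add_left, hx, hx', star_add, add_mul, map_add]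
  | ht _ _ a b _ _ =>
    induction y using induction_homogeneous with
    | h0 => simp
    | ha y y' hy hy' => rw [map_add, inner_add_right, hy, hy', mul_add, map_add]
    | ht _ _ a' b' _ _ =>
      rw [inner_prodMap_tmul hv₁ hv₂, prodFunctional_star_tmul_mul_tmul h₁]

lemma isPositiveFunctional_prodFunctional (h₁ : IsEvenState g₁ ω₁) (h₂ : IsState ω₂) :
    IsPositiveFunctional (prodFunctional g₁ g₂ ω₁ ω₂) := by
  obtain ⟨_, _, _, _, v₁, hv₁⟩ := h₁.isPositiveFunctional.exists_isGNSMap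
  obtain ⟨_, _, _, _, v₂, hv₂⟩ := h₂.isPositiveFunctional.exists_isGNSMap
  exact isPositiveFunctional_of_eq_inner (v := prodMap g₁ g₂ v₁ v₂) fun x =>
    (inner_prodMap h₁ hv₁ hv₂ x x).symm

lemma norm_mul_norm_le_of_isGNS (h₁ : IsEvenState g₁ ω₁) (h₂ : IsState ω₂) {H : Type*}
    [NormedAddCommGroup H] [InnerProductSpace ℂ H] [CompleteSpace H]
    {π : FermiProduct g₁ g₂ →⋆ₐ[ℂ] (H →L[ℂ] H)} {ξ : H}
    (hξ : IsGNS (prodFunctional g₁ g₂ ω₁ ω₂) π ξ) {a : A} {b : B}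
    (ha : ω₁ (star a * a) = (‖a‖ ^ 2 : ℝ)) (hb : ω₂ (star b * b) = (‖b‖ ^ 2 : ℝ)) :
    ‖a‖ * ‖b‖ ≤ ‖π (tmul g₁ g₂ a b)‖ := by
  have h_one : prodFunctional g₁ g₂ ω₁ ω₂ 1 = 1 :=
    (prodFunctional_tmul 1 1).trans (by rw [h₁.map_one, h₂.map_one, mul_one])
  have h_tmul : prodFunctional g₁ g₂ ω₁ ω₂ (star (tmul g₁ g₂ a b) * tmul g₁ g₂ a b) =
      ((‖a‖ * ‖b‖) ^ 2 : ℝ) := by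
    rw [prodFunctional_star_tmul_mul_tmul h₁, ha, hb, mul_pow, Complex.ofReal_mul]
  have h_sq := hξ.apply_star_mul_self_le (tmul g₁ g₂ a b)
  rw [h_tmul, h_one, mul_one, Complex.real_le_real] at h_sq
  exact le_of_sq_le_sq h_sq (norm_nonneg _)

theorem FermiProduct.eq_zero_of_forall_prodFunctional {x : FermiProduct g₁ g₂}
    (hx : ∀ ω₁ ω₂, IsEvenState g₁ ω₁ → IsEvenState g₂ ω₂ → ∀ a b,
      prodFunctional g₁ g₂ ω₁ ω₂ (star (tmul g₁ g₂ a b) * x) = 0) : x = 0 := by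
  refine (GradedTensorProduct.of ℂ g₁.part g₂.part).symm.map_eq_zero_iff.mp <|
    tensor_eq_zero_of_forall_map_eq_zero
      (f := fun p : {ω // IsEvenState g₁ ω} × A => p.1.1 ∘ₗ LinearMap.mulLeft ℂ (star p.2))
      (g := fun q : {ω // IsEvenState g₂ ω} × B => q.1.1 ∘ₗ LinearMap.mulLeft ℂ (star q.2))
      (fun a ha => g₁.eq_zero_of_forall_isEvenState fun ω hω => ha (⟨ω, hω⟩, a))
      (fun b hb => g₂.eq_zero_of_forall_isEvenState fun ω hω => hb (⟨ω, hω⟩, b)) fun p q => ?_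
  rw [← hx p.1.1 q.1.1 p.1.2 q.1.2 p.2 q.2,
    prodFunctional_star_tmul_mul p.1.2]
  rfl

end ProductFunctional

section Norms

variable {g₁ : Z2Grading A} {g₂ : Z2Grading B}

/-- A representation of the Fermi product is spatial if it is the GNS representation of the product
of two even states. These are the representations defining the spatial norm. -/
def HilbertRep.IsSpatial (ρ : HilbertRep (FermiProduct g₁ g₂)) : Prop :=
  ∃ ω₁ ω₂ ξ, IsEvenState g₁ ω₁ ∧ IsEvenState g₂ ω₂ ∧ IsGNS (prodFunctional g₁ g₂ ω₁ ω₂) ρ.π ξ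

lemma exists_isSpatial {ω₁ : A →ₗ[ℂ] ℂ} {ω₂ : B →ₗ[ℂ] ℂ} (h₁ : IsEvenState g₁ ω₁)
    (h₂ : IsEvenState g₂ ω₂) : ∃ (ρ : HilbertRep (FermiProduct g₁ g₂)) (ξ : ρ.H),
      ρ.IsSpatial ∧ IsGNS (prodFunctional g₁ g₂ ω₁ ω₂) ρ.π ξ := by
  obtain ⟨ρ, ξ, hξ⟩ :=
    FermiProduct.exists_isGNS (isPositiveFunctional_prodFunctional h₁ h₂.toIsState)
  exact ⟨ρ, ξ, ⟨ω₁, ω₂, ξ, h₁, h₂, hξ⟩, hξ⟩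

lemma eq_zero_of_forall_isSpatial {x : FermiProduct g₁ g₂}
    (hx : ∀ ρ : HilbertRep (FermiProduct g₁ g₂), ρ.IsSpatial → ρ.π x = 0) : x = 0 := by
  refine FermiProduct.eq_zero_of_forall_prodFunctional fun ω₁ ω₂ h₁ h₂ a b => ?_
  obtain ⟨ρ, ξ, hρ, hξ⟩ := exists_isSpatial h₁ h₂
  rw [← hξ.inner_apply_apply, hx ρ hρ, zero_apply, inner_zero_right]

lemma exists_isSpatial_norm_mul_norm_le {a : A} {b : B} (ha : g₁.IsHomogeneous a)
    (hb : g₂.IsHomogeneous b) (ha_ne : a ≠ 0) (hb_ne : b ≠ 0) :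
    ∃ ρ : HilbertRep (FermiProduct g₁ g₂), ρ.IsSpatial ∧
      ‖a‖ * ‖b‖ ≤ ‖ρ.π (FermiProduct.tmul g₁ g₂ a b)‖ := by
  obtain ⟨ω₁, h₁, hω₁⟩ := ha.exists_isEvenState_apply_star_mul_self ha_ne
  obtain ⟨ω₂, h₂, hω₂⟩ := hb.exists_isEvenState_apply_star_mul_self hb_ne
  obtain ⟨ρ, ξ, hρ, hξ⟩ := exists_isSpatial h₁ h₂
  exact ⟨ρ, hρ, norm_mul_norm_le_of_isGNS h₁ h₂.toIsState hξ hω₁ hω₂⟩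

lemma bddAbove_image_norm_apply (P : Set (HilbertRep (FermiProduct g₁ g₂)))
    (x : FermiProduct g₁ g₂) : BddAbove ((fun ρ => ‖ρ.π x‖) '' P) :=
  (FermiProduct.bddAbove_range_norm_apply x).mono (Set.image_subset_range _ _)

variable {P : Set (HilbertRep (FermiProduct g₁ g₂))}

lemma isCStarNorm_sSup_norm_apply (hP : {ρ | ρ.IsSpatial} ⊆ P) :
    IsCStarNorm fun x : FermiProduct g₁ g₂ => sSup ((fun ρ => ‖ρ.π x‖) '' P) := by
  have h_bdd := bddAbove_image_norm_apply P
  have h_seminorm : IsCStarSeminorm fun x : FermiProduct g₁ g₂ =>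
      sSup ((fun ρ => ‖ρ.π x‖) '' P) := by
    simp only [sSup_image']
    exact .iSup (fun ρ => isCStarSeminorm_norm_apply ρ.1.π) fun x => by
      simpa only [Set.image_eq_range] using h_bdd x
  refine h_seminorm.isCStarNorm fun x hx => eq_zero_of_forall_isSpatial fun ρ hρ => ?_
  exact norm_le_zero_iff.mp (hx ▸ le_csSup (h_bdd x) ⟨ρ, hP hρ, rfl⟩)

theorem isCrossNorm_sSup_norm_apply (hP : {ρ | ρ.IsSpatial} ⊆ P) :
    IsCrossNorm g₁ g₂ fun x => sSup ((fun ρ => ‖ρ.π x‖) '' P) := by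
  refine ⟨isCStarNorm_sSup_norm_apply hP, fun a b ha hb => le_antisymm ?_ ?_⟩
  · exact Real.sSup_le (Set.forall_mem_image.mpr fun ρ _ => FermiProduct.norm_apply_tmul_le ρ.π a b)
      (by positivity)
  · by_cases h_ne : a ≠ 0 ∧ b ≠ 0
    · obtain ⟨ρ, hρ, h_le⟩ := exists_isSpatial_norm_mul_norm_le ha hb h_ne.1 h_ne.2
      exact h_le.trans (le_csSup (bddAbove_image_norm_apply P _) ⟨ρ, hP hρ, rfl⟩)
    · have h_zero : ‖a‖ * ‖b‖ = 0 := by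
        rw [mul_eq_zero, norm_eq_zero, norm_eq_zero]
        tauto
      rw [h_zero]
      exact Real.sSup_nonneg (Set.forall_mem_image.mpr fun ρ _ => norm_nonneg _)

lemma maxNormSet_eq_image (x : FermiProduct g₁ g₂) :
    maxNormSet g₁ g₂ x = (fun ρ : HilbertRep (FermiProduct g₁ g₂) => ‖ρ.π x‖) '' Set.univ := by
  ext r
  constructor
  · rintro ⟨H, _, _, _, π, rfl⟩
    exact ⟨⟨H, π⟩, Set.mem_univ _, rfl⟩
  · rintro ⟨ρ, _, rfl⟩
    exact ⟨ρ.H, _, _, ρ.completeSpace, ρ.π, rfl⟩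

lemma spatialNormSet_eq_image (x : FermiProduct g₁ g₂) :
    spatialNormSet g₁ g₂ x =
      (fun ρ : HilbertRep (FermiProduct g₁ g₂) => ‖ρ.π x‖) '' {ρ | ρ.IsSpatial} := by
  ext r
  constructor
  · rintro ⟨ω₁, ω₂, h₁, h₂, H, _, _, _, π, ξ, hξ, rfl⟩
    exact ⟨⟨H, π⟩, ⟨ω₁, ω₂, ξ, h₁, h₂, hξ⟩, rfl⟩
  · rintro ⟨ρ, ⟨ω₁, ω₂, ξ, h₁, h₂, hξ⟩, rfl⟩
    exact ⟨ω₁, ω₂, h₁, h₂, ρ.H, _, _, ρ.completeSpace, ρ.π, ξ, hξ, rfl⟩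

end Norms

end

/-- The maximal norm and the spatial norm are (finite) C⋆-cross norms on the Fermi product. -/
theorem mainTheorem8 {A : Type u} [CStarAlgebra A] {B : Type v} [CStarAlgebra B]
    (g₁ : Z2Grading A) (g₂ : Z2Grading B) :
    ((∀ x, BddAbove (maxNormSet g₁ g₂ x)) ∧ IsCrossNorm g₁ g₂ (maxNorm g₁ g₂)) ∧
    ((∀ x, BddAbove (spatialNormSet g₁ g₂ x)) ∧ IsCrossNorm g₁ g₂ (spatialNorm g₁ g₂)) := by
  unfold maxNorm spatialNorm
  simp only [maxNormSet_eq_image, spatialNormSet_eq_image]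
  exact ⟨⟨bddAbove_image_norm_apply _, isCrossNorm_sSup_norm_apply (Set.subset_univ _)⟩,
    bddAbove_image_norm_apply _, isCrossNorm_sSup_norm_apply subset_rfl⟩
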